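/- Let $(X,d)$ be a nonempty proper metric space (closed balls are compact) and let $x_0\in X$. Let $\mathcal P_1(X)$ be the set of Borel probability measures $\mu$ on $X$ with $\int_X d(x_0,x)\,d\mu(x)<\infty$, and let $$W_1(\mu,\nu)=\inf_{\gamma\in\Pi(\mu,\nu)}\int_{X\times X}d(x,y)\,d\gamma(x,y),$$ where $\Pi(\mu,\nu)$ is the set of Borel probability measures on $X\times X$ with marginals $\mu$ and $\nu$. Let $N\ge 1$, $\nu_1,\dots,\nu_N\in\mathcal P_1(X)$ and $\lambda_1,\dots,\lambda_N>0$ with $\sum_{i=1}^N\lambda_i=1$. Let $Y_b$ be the set of continuous $f:X\to\mathbb R$ with $\sup_{x\in X}\frac{|f(x)|}{1+d(x,x_0)}<\infty$, and for $u:X\to\mathbb R$ let $$u^{c_i}(x)=\inf_{y\in X}\{\lambda_i d(x,y)-u(y)\}\in[-\infty,\infty).$$ Integrals of $u^{c_i}$ are taken in $[-\infty,\infty)$. Then $$\min_{\mu\in\mathcal P_1(X)}\sum_{i=1}^N\lambda_iW_1(\nu_i,\mu) =\sup\Big\{\sum_{i=1}^N\int_X u_i^{c_i}\,d\nu_i:\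 u_i\in Y_b,\ \sum_{i=1}^N u_i=0\Big\} =\max\Big\{\sum_{i=1}^N\int_X u_i\,d\nu_i:\ u_i:X\to\mathbb R\ \lambda_i\text{-Lipschitz},\ \sum_{i=1}^N u_i\le 0\Big\}.$$ The common value is a finite real number, and both the minimum on the left and the maximum on the right are attained. -/

import Mathlib

open MeasureTheory
open scoped ENNReal

namespace WassersteinMedian

noncomputable section

/-- Borel probability measures on `X` with finite first moment. -/
def P1 (X : Type*) [MetricSpace X] [MeasurableSpace X] : Set (Measure X) :=
  {μ | IsProbabilityMeasure μ ∧ ∃ x₀ : X, Integrable (fun x => dist x₀ x) μ}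

/-- Transport plans: probability measures on `X × X` with marginals `μ` and `ν`. -/
def plans {X : Type*} [MeasurableSpace X] (μ ν : Measure X) : Set (Measure (X × X)) :=
  {γ | IsProbabilityMeasure γ ∧ γ.map Prod.fst = μ ∧ γ.map Prod.snd = ν}

/-- The Wasserstein distance of order one (finite when both measures lie in `P1 X`). -/
def W1 {X : Type*} [MetricSpace X] [MeasurableSpace X] (μ ν : Measure X) : ℝ≥0∞ :=
  ⨅ γ ∈ plans μ ν, ∫⁻ p, edist p.1 p.2 ∂γ

/-- The weighted dispersion functional `μ ↦ ∑ i, lam i * W1 (ν i) μ`. -/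
def dispersion {X : Type*} [MetricSpace X] [MeasurableSpace X] {N : ℕ}
    (lam : Fin N → ℝ) (ν : Fin N → Measure X) (μ : Measure X) : ℝ≥0∞ :=
  ∑ i, ENNReal.ofReal (lam i) * W1 (ν i) μ

/-- The values of the Wasserstein median problem. -/
def medianValues {X : Type*} [MetricSpace X] [MeasurableSpace X] {N : ℕ}
    (lam : Fin N → ℝ) (ν : Fin N → Measure X) : Set EReal :=
  {r | ∃ μ ∈ P1 X, r = ((dispersion lam ν μ : ℝ≥0∞) : EReal)}

/-- Continuous functions with at most linear growth (with respect to the base point `x₀`). -/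
def Yb {X : Type*} [MetricSpace X] (x₀ : X) : Set (X → ℝ) :=
  {f | Continuous f ∧ ∃ C : ℝ, ∀ x, |f x| / (1 + dist x x₀) ≤ C}

/-- Functions that are Lipschitz with constant `l`. -/
def Lip (X : Type*) [MetricSpace X] (l : ℝ) : Set (X → ℝ) :=
  {v | ∀ x y, |v x - v y| ≤ l * dist x y}

/-- The `c`-transform for the cost `c = l * dist`; it may take the value `-∞`. -/
def cTransform {X : Type*} [MetricSpace X] (l : ℝ) (u : X → ℝ) (x : X) : EReal :=
  ⨅ y : X, ((l * dist x y - u y : ℝ) : EReal)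

/-- The integral of an extended-real function: integral of the positive part minus integral of
the negative part. It is used only for `c`-transforms of functions in `Yb`, whose positive part
always has a finite integral against measures in `P1`, so `∞ - ∞` does not occur. -/
def extIntegral {X : Type*} [MeasurableSpace X] (f : X → EReal) (ν : Measure X) : EReal :=
  ((∫⁻ x, (f x).toENNReal ∂ν : ℝ≥0∞) : EReal) - ((∫⁻ x, (-f x).toENNReal ∂ν : ℝ≥0∞) : EReal)

/-- The values of the relaxed dual problem over tuples in `Yb` summing to zero. -/
def relaxedDualValues {X : Type*} [MetricSpace X] [MeasurableSpace X] {N : ℕ} (x₀ : X)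
    (lam : Fin N → ℝ) (ν : Fin N → Measure X) : Set EReal :=
  {r | ∃ u : Fin N → X → ℝ, (∀ i, u i ∈ Yb x₀) ∧ (∀ x, ∑ i, u i x = 0) ∧
    r = ∑ i, extIntegral (cTransform (lam i) (u i)) (ν i)}

/-- The values of the Lipschitz dual problem. -/
def lipDualValues {X : Type*} [MetricSpace X] [MeasurableSpace X] {N : ℕ}
    (lam : Fin N → ℝ) (ν : Fin N → Measure X) : Set ℝ :=
  {r | ∃ u : Fin N → X → ℝ, (∀ i, u i ∈ Lip X (lam i)) ∧ (∀ x, ∑ i, u i x ≤ 0) ∧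
    r = ∑ i, ∫ x, u i x ∂(ν i)}

end

end WassersteinMedian

namespace WassersteinMedian

open Filter Topology

/-! The value `v` is defined as the Lipschitz dual maximum; the other two problems are compared with
it. The relaxed dual reduces to the Lipschitz one by `c`-transforms: a transform is either
identically `⊥` or `λ_i`-Lipschitz, and since `u_i^{c_i} ≤ -u_i` the transforms again sum to at most
zero (`relaxedDualValue_eq_bot_or_mem`). Conversely, an admissible Lipschitz tuple is dominated by
the transforms of a tuple with zero sum (`exists_relaxedDualValue_ge`). The dual maximum exists by
compactness: after normalization at `x₀`, a maximizing sequence is equi-Lipschitz and pointwise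
bounded (`exists_isGreatest_lipDualValues`). Weak duality integrates the Lipschitz inequality
against plans (`ofReal_le_dispersion`). For the reverse inequality, a sublinear functional encodes
the marginal constraints and the cost bound `v`; it is finite precisely because `v` bounds the
Lipschitz dual (`le_of_mem_gapValues`). A linear functional below it, from Hahn-Banach, splits into
`N` positive functionals, and the Riesz theorem turns these into plans from the `ν_i` to one common
marginal with total cost at most `v` (`exists_plans`). That marginal is a median, so the minimum is
attained without a separate compactness argument for measures. -/

lemma ereal_coe_sum {ι : Type*} (s : Finset ι) (f : ι → ℝ) :
    ((∑ i ∈ s, f i : ℝ) : EReal) = ∑ i ∈ s, (f i : EReal) := by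
  classical
  induction s using Finset.induction_on with
  | empty => simp
  | insert a s ha ih => rw [Finset.sum_insert ha, Finset.sum_insert ha, EReal.coe_add, ih]

/-! ### Lipschitz functions and infimal convolutions. -/

section Basic

variable {X : Type*} [MetricSpace X]

lemma lipschitzWith_of_mem_Lip {l : ℝ} {u : X → ℝ} (hu : u ∈ Lip X l) :
    LipschitzWith l.toNNReal u :=
  LipschitzWith.of_dist_le' fun x y => by simpa [Real.dist_eq] using hu x y

lemma abs_le_of_mem_Lip {l : ℝ} {u : X → ℝ} (hu : u ∈ Lip X l) (a x : X) :
    |u x| ≤ |u a| + l * dist a x := by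
  have h1 := hu x a
  have h2 : |u x| ≤ |u x - u a| + |u a| := by
    simpa using abs_add_le (u x - u a) (u a)
  rw [dist_comm] at h1
  linarith

/-- By the triangle inequality, changing the base point costs at most a constant. Hence a
`c`-transform is finite everywhere or nowhere. -/
lemma bddBelow_infConv {l : ℝ} (hl : 0 ≤ l) {ψ : X → ℝ} {a : X}
    (h : BddBelow (Set.range fun y => l * dist a y - ψ y)) (x : X) :
    BddBelow (Set.range fun y => l * dist x y - ψ y) := by
  obtain ⟨B, hB⟩ := h
  refine ⟨B - l * dist a x, ?_⟩
  rintro _ ⟨y, rfl⟩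
  have h1 : B ≤ l * dist a y - ψ y := hB ⟨y, rfl⟩
  have h2 := mul_le_mul_of_nonneg_left (dist_triangle a x y) hl
  simp only
  linarith

lemma infConv_mem_Lip {l : ℝ} (hl : 0 ≤ l) {ψ : X → ℝ}
    (h : ∀ x, BddBelow (Set.range fun y => l * dist x y - ψ y)) :
    (fun x => ⨅ y, (l * dist x y - ψ y)) ∈ Lip X l := by
  have key : ∀ x z : X, (⨅ y, (l * dist x y - ψ y)) ≤ (⨅ y, (l * dist z y - ψ y)) + l * dist x z := by
    intro x z
    have : Nonempty X := ⟨x⟩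
    rw [← sub_le_iff_le_add]
    refine le_ciInf fun y => ?_
    have h1 := ciInf_le (h x) y
    have h2 := mul_le_mul_of_nonneg_left (dist_triangle x z y) hl
    linarith
  intro x z
  rw [abs_sub_le_iff]
  have h1 := key x z
  have h2 := key z x
  rw [dist_comm z x] at h2
  constructor <;> linarith

lemma cTransform_eq_coe {l : ℝ} {u : X → ℝ} {x : X}
    (h : BddBelow (Set.range fun y => l * dist x y - u y)) :
    cTransform l u x = ((⨅ y, (l * dist x y - u y) : ℝ) : EReal) := by
  have : Nonempty X := ⟨x⟩
  apply le_antisymm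
  · have hle : ∀ y, cTransform l u x ≤ ((l * dist x y - u y : ℝ) : EReal) := fun y => iInf_le _ y
    generalize cTransform l u x = a at hle ⊢
    induction a with
    | bot => exact bot_le
    | top => exact absurd (hle x) (by simp)
    | coe r =>
      rw [EReal.coe_le_coe_iff]
      exact le_ciInf fun y => by exact_mod_cast hle y
  · exact le_iInf fun y => EReal.coe_le_coe_iff.2 (ciInf_le h y)

lemma cTransform_eq_bot {l : ℝ} {u : X → ℝ} {x : X}
    (h : ¬ BddBelow (Set.range fun y => l * dist x y - u y)) :
    cTransform l u x = ⊥ := by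
  refine EReal.eq_bot_iff_forall_lt _ |>.2 fun b => ?_
  rw [not_bddBelow_iff] at h
  obtain ⟨_, ⟨y, rfl⟩, hy⟩ := h b
  exact (iInf_le _ y).trans_lt (EReal.coe_lt_coe_iff.2 hy)

lemma mem_Yb_of_mem_Lip {l : ℝ} (hl : 0 ≤ l) {u : X → ℝ} (hu : u ∈ Lip X l) (x₀ : X) :
    u ∈ Yb x₀ := by
  refine ⟨(lipschitzWith_of_mem_Lip hu).continuous, |u x₀| + l, fun x => ?_⟩
  rw [div_le_iff₀ (by positivity)]
  have h := abs_le_of_mem_Lip hu x₀ x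
  rw [dist_comm] at h
  nlinarith [abs_nonneg (u x₀), dist_nonneg (x := x) (y := x₀)]

lemma sum_mem_Lip {N : ℕ} {lam : Fin N → ℝ} {u : Fin N → X → ℝ} (hu : ∀ i, u i ∈ Lip X (lam i)) :
    (fun x => ∑ i, u i x) ∈ Lip X (∑ i, lam i) := by
  intro x y
  simp only
  rw [← Finset.sum_sub_distrib, Finset.sum_mul]
  exact (Finset.abs_sum_le_sum_abs _ _).trans (Finset.sum_le_sum fun i _ => hu i x y)

end Basic

/-! ### Integrals with values in the extended reals. -/

section ExtIntegral

variable {X : Type*} [MeasurableSpace X]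

lemma extIntegral_coe {μ : Measure X} {g : X → ℝ} (hg : Integrable g μ) :
    extIntegral (fun x => (g x : EReal)) μ = ((∫ x, g x ∂μ : ℝ) : EReal) := by
  have h1 : ∫⁻ x, ENNReal.ofReal (g x) ∂μ ≠ ⊤ := hg.lintegral_lt_top.ne
  have h2 : ∫⁻ x, ENNReal.ofReal (-g x) ∂μ ≠ ⊤ := hg.neg.lintegral_lt_top.ne
  rw [integral_eq_lintegral_pos_part_sub_lintegral_neg_part hg, EReal.coe_sub,
    EReal.coe_ennreal_toReal h1, EReal.coe_ennreal_toReal h2]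
  rfl

lemma extIntegral_bot {μ : Measure X} [IsProbabilityMeasure μ] :
    extIntegral (fun _ => ⊥) μ = ⊥ := by
  simp [extIntegral]

end ExtIntegral

/-! ### Comparison of the two dual problems, and weak duality. -/

section Measurable

lemma integrable_dist {X : Type*} [MetricSpace X] [MeasurableSpace X] [BorelSpace X]
    {μ : Measure X} (hμ : μ ∈ P1 X) (a : X) :
    Integrable (fun x => dist a x) μ := by
  obtain ⟨hp, b, hb⟩ := hμ
  refine ((integrable_const (dist a b)).add hb).mono'
    (continuous_const.dist continuous_id).aestronglyMeasurable (ae_of_all _ fun x => ?_)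
  simpa using dist_triangle a b x

lemma integrable_of_mem_Lip {X : Type*} [MetricSpace X] [MeasurableSpace X] [BorelSpace X]
    {μ : Measure X} (hμ : μ ∈ P1 X)
    {l : ℝ} {u : X → ℝ}
    (hu : u ∈ Lip X l) : Integrable u μ := by
  have := hμ.1
  rcases isEmpty_or_nonempty X with h | ⟨⟨a⟩⟩
  · simp [Measure.eq_zero_of_isEmpty μ]
  refine ((integrable_const |u a|).add ((integrable_dist hμ a).const_mul l)).mono'
    (lipschitzWith_of_mem_Lip hu).continuous.aestronglyMeasurable (ae_of_all _ fun x => ?_)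
  simpa using abs_le_of_mem_Lip hu a x

variable {X : Type*} [MetricSpace X] [MeasurableSpace X] [BorelSpace X]

variable {N : ℕ} {lam : Fin N → ℝ} {ν : Fin N → Measure X}

lemma relaxedDualValue_eq_bot_or_mem (hpos : ∀ i, 0 < lam i) (hν : ∀ i, ν i ∈ P1 X) (x₀ : X)
    {r : EReal} (hr : r ∈ relaxedDualValues x₀ lam ν) :
    r = ⊥ ∨ ∃ s ∈ lipDualValues lam ν, r = (s : EReal) := by
  obtain ⟨u, -, hsum, rfl⟩ := hr
  by_cases hb : ∀ i x, BddBelow (Set.range fun y => lam i * dist x y - u i y)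
  · right
    have hL := fun i => infConv_mem_Lip (hpos i).le (hb i)
    refine ⟨_, ⟨fun i x => ⨅ y, (lam i * dist x y - u i y), hL, fun x => ?_, rfl⟩, ?_⟩
    -- Taking `y = x` in each infimum gives `u_i^{c_i} ≤ -u_i`.
    · have : ∑ i, (⨅ y, (lam i * dist x y - u i y)) ≤ ∑ i, - u i x :=
        Finset.sum_le_sum fun i _ => by simpa using ciInf_le (hb i x) x
      simpa [hsum x] using this
    · rw [ereal_coe_sum]
      refine Finset.sum_congr rfl fun i _ => ?_
      rw [← extIntegral_coe (integrable_of_mem_Lip (hν i) (hL i))]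
      congr 1
      exact funext fun x => cTransform_eq_coe (hb i x)
  · left
    push Not at hb
    obtain ⟨i, a, ha⟩ := hb
    -- Unboundedness at one point spreads to every point, and a single `⊥` summand absorbs the whole
    -- sum, even against `⊤`.
    have : cTransform (lam i) (u i) = fun _ => ⊥ := funext fun x =>
      cTransform_eq_bot fun h => ha (bddBelow_infConv (hpos i).le h a)
    have hprob := (hν i).1
    rw [← Finset.add_sum_erase _ _ (Finset.mem_univ i), this, extIntegral_bot, EReal.bot_add]

lemma exists_relaxedDualValue_ge [NeZero N] (hpos : ∀ i, 0 < lam i) (hν : ∀ i, ν i ∈ P1 X)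
    (x₀ : X) {s : ℝ} (hs : s ∈ lipDualValues lam ν) :
    ∃ r ∈ relaxedDualValues x₀ lam ν, (s : EReal) ≤ r := by
  obtain ⟨u, hu, hsum, rfl⟩ := hs
  have hN : (0 : ℝ) < N := by exact_mod_cast Nat.pos_of_ne_zero (NeZero.ne N)
  -- Sharing the deficit `∑ u_j ≤ 0` equally among the `-u_i` makes the sum exactly zero and keeps
  -- `w_i ≤ -u_i`, whence `u_i ≤ w_i^{c_i}`.
  set w : Fin N → X → ℝ := fun i x => -u i x + (∑ j, u j x) / N with hw
  have hwu : ∀ i x, w i x ≤ - u i x := fun i x => by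
    have := div_nonpos_of_nonpos_of_nonneg (hsum x) hN.le
    simp only [hw]; linarith
  have hlow : ∀ i x y, u i x ≤ lam i * dist x y - w i y := fun i x y => by
    have := le_of_abs_le (hu i x y)
    have := hwu i y
    linarith
  have hb : ∀ i x, BddBelow (Set.range fun y => lam i * dist x y - w i y) := fun i x =>
    ⟨u i x, by rintro _ ⟨y, rfl⟩; exact hlow i x y⟩
  have hL := fun i => infConv_mem_Lip (hpos i).le (hb i)
  refine ⟨_, ⟨w, fun i => ?_, fun x => ?_, rfl⟩, ?_⟩
  · refine mem_Yb_of_mem_Lip (l := lam i + (∑ j, lam j) / N) ?_ ?_ x₀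
    · have := Finset.sum_nonneg fun j (_ : j ∈ Finset.univ) => (hpos j).le
      have := (hpos i).le
      positivity
    · intro x y
      have h1 := hu i x y
      have h2 := sum_mem_Lip hu x y
      have h3 : w i x - w i y = -(u i x - u i y) + (∑ j, u j x - ∑ j, u j y) / N := by
        simp only [hw]; ring
      rw [h3]
      refine (abs_add_le _ _).trans ?_
      rw [abs_neg, abs_div, abs_of_pos hN, add_mul, div_mul_eq_mul_div]
      gcongr
  · simp only [hw, Finset.sum_add_distrib, Finset.sum_neg_distrib, Finset.sum_const,
      Finset.card_univ, Fintype.card_fin, nsmul_eq_mul]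
    field_simp
    ring
  · rw [ereal_coe_sum]
    refine Finset.sum_le_sum fun i _ => ?_
    have : cTransform (lam i) (w i) = fun x => ((⨅ y, (lam i * dist x y - w i y) : ℝ) : EReal) :=
      funext fun x => cTransform_eq_coe (hb i x)
    rw [this, extIntegral_coe (integrable_of_mem_Lip (hν i) (hL i)), EReal.coe_le_coe_iff]
    refine integral_mono (integrable_of_mem_Lip (hν i) (hu i))
      (integrable_of_mem_Lip (hν i) (hL i)) fun x => ?_
    have : Nonempty X := ⟨x⟩
    exact le_ciInf fun y => hlow i x y

variable [SecondCountableTopology X]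

/-- The easy half of Kantorovich-Rubinstein duality: for any plan the left side is the integral of
`u p.1 - u p.2`, which the Lipschitz bound controls by the cost. -/
lemma ofReal_integral_sub_le_W1 {l : ℝ} (hl : 0 < l) {μ ρ : Measure X} (hμ : μ ∈ P1 X)
    (hρ : ρ ∈ P1 X) {u : X → ℝ} (hu : u ∈ Lip X l) :
    ENNReal.ofReal (∫ x, u x ∂μ - ∫ x, u x ∂ρ) ≤ ENNReal.ofReal l * W1 μ ρ := by
  -- Dividing by `l` isolates the infimum over plans, so that one plan can be fixed.
  rw [mul_comm, ← ENNReal.div_le_iff (by simpa using hl) ENNReal.ofReal_ne_top]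
  refine le_iInf₂ fun γ ⟨_, h1, h2⟩ => ?_
  rw [ENNReal.div_le_iff (by simpa using hl) ENNReal.ofReal_ne_top]
  have i1 : Integrable u (γ.map Prod.fst) := h1 ▸ integrable_of_mem_Lip hμ hu
  have i2 : Integrable u (γ.map Prod.snd) := h2 ▸ integrable_of_mem_Lip hρ hu
  have j1 : Integrable (fun p : X × X => u p.1) γ := i1.comp_measurable measurable_fst
  have j2 : Integrable (fun p : X × X => u p.2) γ := i2.comp_measurable measurable_snd
  rw [← h1, ← h2, integral_map measurable_fst.aemeasurable i1.1,
    integral_map measurable_snd.aemeasurable i2.1, ← integral_sub j1 j2]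
  have hle : ∀ r : ℝ, ENNReal.ofReal r ≤ ‖r‖ₑ := fun r => by
    rw [← ofReal_norm]
    exact ENNReal.ofReal_le_ofReal (le_abs_self r)
  refine (hle _).trans ((enorm_integral_le_lintegral_enorm _).trans ?_)
  rw [mul_comm, ← lintegral_const_mul _ (by fun_prop)]
  refine lintegral_mono fun p => ?_
  rw [← ofReal_norm, edist_dist, ← ENNReal.ofReal_mul hl.le]
  exact ENNReal.ofReal_le_ofReal (hu p.1 p.2)

lemma ofReal_le_dispersion (hpos : ∀ i, 0 < lam i) (hν : ∀ i, ν i ∈ P1 X) {μ : Measure X}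
    (hμ : μ ∈ P1 X) {s : ℝ} (hs : s ∈ lipDualValues lam ν) :
    ENNReal.ofReal s ≤ dispersion lam ν μ := by
  obtain ⟨u, hu, hsum, rfl⟩ := hs
  have h0 : ∑ i, ∫ x, u i x ∂μ ≤ 0 := by
    rw [← integral_finsetSum _ fun i _ => integrable_of_mem_Lip hμ (hu i)]
    exact integral_nonpos hsum
  calc ENNReal.ofReal (∑ i, ∫ x, u i x ∂ν i)
      ≤ ENNReal.ofReal (∑ i, (∫ x, u i x ∂ν i - ∫ x, u i x ∂μ)) := by
        apply ENNReal.ofReal_le_ofReal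
        rw [Finset.sum_sub_distrib]
        linarith
    _ ≤ ∑ i, ENNReal.ofReal (∫ x, u i x ∂ν i - ∫ x, u i x ∂μ) :=
        Finset.le_sum_of_subadditive _ ENNReal.ofReal_zero.le
          (fun _ _ => ENNReal.ofReal_add_le) _ _
    _ ≤ _ := Finset.sum_le_sum fun i _ => ofReal_integral_sub_le_W1 (hpos i) (hν i) hμ (hu i)

end Measurable

/-! ### Existence of a maximizer for the Lipschitz dual. -/

section Attainment

variable {X : Type*} [MetricSpace X]

/-- Equi-Lipschitz functions converging on a dense set converge everywhere. -/
lemma exists_tendsto_of_tendsto_dense {l : ℝ} (hl : 0 < l) {u : ℕ → X → ℝ}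
    (hu : ∀ n, u n ∈ Lip X l) {D : Set X} (hD : Dense D)
    (h : ∀ y ∈ D, ∃ b, Tendsto (fun n => u n y) atTop (𝓝 b)) (x : X) :
    ∃ b, Tendsto (fun n => u n x) atTop (𝓝 b) := by
  refine cauchySeq_tendsto_of_complete (Metric.cauchySeq_iff.2 fun ε hε => ?_)
  obtain ⟨y, hy, hyx⟩ := Metric.mem_closure_iff.1 (hD x) (ε / (3 * l)) (by positivity)
  obtain ⟨b, hb⟩ := h y hy
  obtain ⟨M, hM⟩ := Metric.cauchySeq_iff.1 hb.cauchySeq (ε / 3) (by positivity)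
  refine ⟨M, fun m hm n hn => ?_⟩
  have h1 := hM m hm n hn
  have h2 := hu m x y
  have h3 := hu n y x
  rw [dist_comm y x] at h3
  have h4 : l * dist x y < ε / 3 := by
    rw [lt_div_iff₀ (by positivity)] at hyx
    linarith
  rw [← Real.dist_eq] at h2 h3
  have h5 := dist_triangle4 (u m x) (u m y) (u n y) (u n x)
  linarith

/-- Equi-Lipschitz tuples, bounded at a point, have a pointwise convergent subsequence. -/
lemma exists_subseq_tendsto [SecondCountableTopology X] {N : ℕ} {lam : Fin N → ℝ}
    (hpos : ∀ i, 0 < lam i) {u : ℕ → Fin N → X → ℝ} (hu : ∀ n i, u n i ∈ Lip X (lam i))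
    (x₀ : X) {C : ℝ} (hC : ∀ n i, |u n i x₀| ≤ C) :
    ∃ (w : Fin N → X → ℝ) (k : ℕ → ℕ), StrictMono k ∧
      ∀ i x, Tendsto (fun n => u (k n) i x) atTop (𝓝 (w i x)) := by
  have : Nonempty X := ⟨x₀⟩
  let D := TopologicalSpace.denseSeq X
  let K : Set (Fin N × ℕ → ℝ) := Set.univ.pi fun p =>
    Set.Icc (-(C + lam p.1 * dist x₀ (D p.2))) (C + lam p.1 * dist x₀ (D p.2))
  have hK : IsCompact K := isCompact_univ_pi fun _ => isCompact_Icc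
  obtain ⟨a, -, k, hk, hlim⟩ := hK.tendsto_subseq (x := fun n p => u n p.1 (D p.2)) fun n p _ => by
    exact abs_le.1 ((abs_le_of_mem_Lip (hu n p.1) x₀ _).trans (by linarith [hC n p.1]))
  have hex : ∀ i x, ∃ b, Tendsto (fun n => u (k n) i x) atTop (𝓝 b) := fun i x => by
    refine exists_tendsto_of_tendsto_dense (hpos i) (fun n => hu (k n) i)
      (TopologicalSpace.denseRange_denseSeq X) ?_ x
    rintro _ ⟨j, rfl⟩
    exact ⟨a (i, j), (tendsto_pi_nhds.1 hlim) (i, j)⟩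
  choose w hw using hex
  exact ⟨w, k, hk, hw⟩

lemma zero_mem_lipDualValues [MeasurableSpace X] {N : ℕ} {lam : Fin N → ℝ}
    {ν : Fin N → Measure X} (hpos : ∀ i, 0 < lam i) : (0 : ℝ) ∈ lipDualValues lam ν :=
  ⟨fun _ _ => 0, fun i x y => by simpa using mul_nonneg (hpos i).le dist_nonneg, by simp, by simp⟩

variable [MeasurableSpace X] [BorelSpace X] {N : ℕ} {lam : Fin N → ℝ}
  {ν : Fin N → Measure X}

/-- Besides bounding the dual values, this bounds `∑ u_i x₀` from below in terms of the dual value,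
which `exists_normalized` needs. -/
lemma lipDualValue_le (hν : ∀ i, ν i ∈ P1 X) (x₀ : X) {u : Fin N → X → ℝ}
    (hu : ∀ i, u i ∈ Lip X (lam i)) :
    ∑ i, ∫ x, u i x ∂ν i ≤ ∑ i, u i x₀ + ∑ i, lam i * ∫ x, dist x₀ x ∂ν i := by
  rw [← Finset.sum_add_distrib]
  refine Finset.sum_le_sum fun i _ => ?_
  have := (hν i).1
  have hd := (integrable_dist (hν i) x₀).const_mul (lam i)
  calc ∫ x, u i x ∂ν i ≤ ∫ x, (u i x₀ + lam i * dist x₀ x) ∂ν i := by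
        refine integral_mono (integrable_of_mem_Lip (hν i) (hu i))
          ((integrable_const _).add hd) fun x => ?_
        have := le_of_abs_le (hu i x x₀)
        rw [dist_comm] at this
        simp only
        linarith
    _ = _ := by rw [integral_add (integrable_const _) hd, integral_const_mul]; simp

lemma bddAbove_lipDualValues (hν : ∀ i, ν i ∈ P1 X) (x₀ : X) :
    BddAbove (lipDualValues lam ν) := by
  refine ⟨∑ i, lam i * ∫ x, dist x₀ x ∂ν i, ?_⟩
  rintro _ ⟨u, hu, hsum, rfl⟩
  linarith [lipDualValue_le hν x₀ hu, hsum x₀]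

/-- Dual values are attained by tuples that agree at the base point. -/
lemma exists_normalized [NeZero N] (hν : ∀ i, ν i ∈ P1 X) (x₀ : X) {s : ℝ}
    (hs : s ∈ lipDualValues lam ν) :
    ∃ u : Fin N → X → ℝ, (∀ i, u i ∈ Lip X (lam i)) ∧ (∀ x, ∑ i, u i x ≤ 0) ∧
      s = ∑ i, ∫ x, u i x ∂(ν i) ∧
      ∀ i, |u i x₀| ≤ |∑ i, lam i * ∫ x, dist x₀ x ∂ν i - s| := by
  obtain ⟨u, hu, hsum, rfl⟩ := hs
  have hN : (1 : ℝ) ≤ N := by exact_mod_cast Nat.pos_of_ne_zero (NeZero.ne N)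
  set σ := ∑ i, u i x₀ with hσ
  have hshift : ∑ i, (σ / N - u i x₀) = 0 := by
    rw [Finset.sum_sub_distrib, ← hσ]
    simp only [Finset.sum_const, Finset.card_univ, Fintype.card_fin, nsmul_eq_mul]
    field_simp
    ring
  -- The added constants sum to zero, so neither the constraint nor the value changes, since each `ν
  -- i` has mass one. All components now equal `σ / N` at `x₀`.
  refine ⟨fun i x => u i x + (σ / N - u i x₀), fun i x y => by simpa using hu i x y,
    fun x => ?_, ?_, fun i => ?_⟩
  · rw [Finset.sum_add_distrib, hshift, add_zero]
    exact hsum x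
  · have : ∀ i, ∫ x, (u i x + (σ / N - u i x₀)) ∂ν i
        = ∫ x, u i x ∂ν i + (σ / N - u i x₀) := fun i => by
      have := (hν i).1
      rw [integral_add (integrable_of_mem_Lip (hν i) (hu i)) (integrable_const _)]
      simp
    simp_rw [this]
    rw [Finset.sum_add_distrib, hshift, add_zero]
  · have h1 := lipDualValue_le hν x₀ hu
    have h2 : σ ≤ 0 := hsum x₀
    simp only [add_sub_cancel]
    have h3 : |σ / N| ≤ |σ| := by
      rw [abs_div]
      exact div_le_self (abs_nonneg _) (hN.trans (le_abs_self _))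
    rw [abs_of_nonpos h2] at h3
    exact h3.trans (le_trans (by linarith) (le_abs_self _))

lemma exists_isGreatest_lipDualValues [SecondCountableTopology X] [NeZero N] (hpos : ∀ i, 0 < lam i)
    (hν : ∀ i, ν i ∈ P1 X) (x₀ : X) : ∃ v, IsGreatest (lipDualValues lam ν) v := by
  have hne : (lipDualValues lam ν).Nonempty := ⟨0, zero_mem_lipDualValues hpos⟩
  have hbdd := bddAbove_lipDualValues (lam := lam) hν x₀
  obtain ⟨r, -, hr, hmem⟩ := exists_seq_tendsto_sSup hne hbdd
  refine ⟨sSup (lipDualValues lam ν), ?_, fun s hs => le_csSup hbdd hs⟩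
  choose u hu hsum hval hx₀ using fun n => exists_normalized hν x₀ (hmem n)
  -- The normalization bounds depend on `n` only through the convergent sequence `r n`, hence are
  -- uniform.
  obtain ⟨C, hC⟩ := ((tendsto_const_nhds
    (x := ∑ i, lam i * ∫ x, dist x₀ x ∂ν i)).sub hr).abs.bddAbove_range
  have hC' : ∀ n i, |u n i x₀| ≤ C := fun n i => (hx₀ n i).trans (hC ⟨n, rfl⟩)
  obtain ⟨w, k, hk, hw⟩ := exists_subseq_tendsto hpos hu x₀ hC'
  refine ⟨w, fun i x y => ?_, fun x => ?_, ?_⟩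
  · exact le_of_tendsto ((hw i x).sub (hw i y)).abs (Eventually.of_forall fun n => hu (k n) i x y)
  · exact le_of_tendsto (tendsto_finsetSum _ fun i _ => hw i x)
      (Eventually.of_forall fun n => hsum (k n) x)
  · refine tendsto_nhds_unique (hr.comp hk.tendsto_atTop) ?_
    have : (r ∘ k) = fun n => ∑ i, ∫ x, u (k n) i x ∂ν i := funext fun n => hval (k n)
    rw [this]
    refine tendsto_finsetSum _ fun i _ => ?_
    have := (hν i).1
    refine tendsto_integral_of_dominated_convergence (fun x => C + lam i * dist x₀ x)
      (fun n => (integrable_of_mem_Lip (hν i) (hu (k n) i)).1)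
      ((integrable_const _).add ((integrable_dist (hν i) x₀).const_mul _))
      (fun n => ae_of_all _ fun x => ?_) (ae_of_all _ fun x => hw i x)
    exact (abs_le_of_mem_Lip (hu (k n) i) x₀ x).trans (by linarith [hC' (k n) i])

end Attainment

/-! ### The sublinear functional and its linear minorant. -/

section HahnBanach

open scoped BoundedContinuousFunction

variable {X : Type*} [MetricSpace X] {N : ℕ}

lemma abs_apply_le_norm (h : Fin N → X × X →ᵇ ℝ) (i : Fin N) (p : X × X) : |h i p| ≤ ‖h‖ :=
  ((h i).norm_coe_le_norm p).trans (norm_le_pi_norm h i)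

variable [MeasurableSpace X]

/-- The infimum of this set is a sublinear functional of `h`; it dominates the transport plans
of an optimal median. -/
def gapValues (lam : Fin N → ℝ) (ν : Fin N → Measure X) (v : ℝ)
    (h : Fin N → X × X →ᵇ ℝ) : Set ℝ :=
  {r | ∃ t : ℝ, 0 < t ∧ ∃ φ ψ : Fin N → X → ℝ, (∀ i, Integrable (φ i) (ν i)) ∧
    (∀ i x y, h i (x, y) + φ i x + ψ i y ≤ t * (lam i * dist x y)) ∧
    (∀ y, 0 ≤ ∑ i, ψ i y) ∧ r = t * v - ∑ i, ∫ x, φ i x ∂ν i}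

variable {lam : Fin N → ℝ} {ν : Fin N → Measure X} {v : ℝ} {h k : Fin N → X × X →ᵇ ℝ}

lemma add_mem_gapValues {r s : ℝ} (hr : r ∈ gapValues lam ν v h) (hs : s ∈ gapValues lam ν v k) :
    r + s ∈ gapValues lam ν v (h + k) := by
  obtain ⟨t, ht, φ, ψ, hφ, hle, hψ, rfl⟩ := hr
  obtain ⟨t', ht', φ', ψ', hφ', hle', hψ', rfl⟩ := hs
  refine ⟨t + t', by positivity, φ + φ', ψ + ψ', fun i => (hφ i).add (hφ' i), fun i x y => ?_,
    fun y => ?_, ?_⟩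
  · have h1 := hle i x y
    have h2 := hle' i x y
    simp only [Pi.add_apply, BoundedContinuousFunction.coe_add]
    linarith
  · simp only [Pi.add_apply, Finset.sum_add_distrib]
    exact add_nonneg (hψ y) (hψ' y)
  · have : ∀ i, ∫ x, (φ + φ') i x ∂ν i = ∫ x, φ i x ∂ν i + ∫ x, φ' i x ∂ν i := fun i =>
      integral_add (hφ i) (hφ' i)
    simp_rw [this, Finset.sum_add_distrib]
    ring

lemma smul_mem_gapValues {c : ℝ} (hc : 0 < c) {r : ℝ} (hr : r ∈ gapValues lam ν v h) :
    c * r ∈ gapValues lam ν v (c • h) := by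
  obtain ⟨t, ht, φ, ψ, hφ, hle, hψ, rfl⟩ := hr
  refine ⟨c * t, by positivity, fun i x => c * φ i x, fun i x => c * ψ i x,
    fun i => (hφ i).const_mul c, fun i x y => ?_, fun y => ?_, ?_⟩
  · have h1 := mul_le_mul_of_nonneg_left (hle i x y) hc.le
    simp only [Pi.smul_apply, BoundedContinuousFunction.coe_smul, smul_eq_mul]
    linarith
  · rw [← Finset.mul_sum]
    exact mul_nonneg hc.le (hψ y)
  · simp_rw [integral_const_mul]
    rw [← Finset.mul_sum]
    ring

lemma gapValues_nonempty (hpos : ∀ i, 0 < lam i) (hν : ∀ i, ν i ∈ P1 X) :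
    (gapValues lam ν v h).Nonempty := by
  refine ⟨_, 1, one_pos, fun _ _ => -‖h‖, fun _ _ => 0, fun i => ?_, fun i x y => ?_, by simp, rfl⟩
  · have := (hν i).1
    exact integrable_const _
  · have h1 := le_of_abs_le (abs_apply_le_norm h i (x, y))
    have h2 := mul_nonneg (hpos i).le (dist_nonneg (x := x) (y := y))
    linarith

variable [BorelSpace X]

/-- Replacing `h` by its lower bound `-‖h‖` and dividing by `t` turns `φ, ψ` into a competitor for
the Lipschitz dual, via infimal convolution. Its value is at most `v`, and multiplying back by `t`
leaves only the error `N * ‖h‖`. -/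
lemma le_of_mem_gapValues (hpos : ∀ i, 0 < lam i) (hν : ∀ i, ν i ∈ P1 X)
    (hv : ∀ s ∈ lipDualValues lam ν, s ≤ v) {r : ℝ} (hr : r ∈ gapValues lam ν v h) :
    -(N * ‖h‖) ≤ r := by
  obtain ⟨t, ht, φ, ψ, hφ, hle, hψ, rfl⟩ := hr
  set K := ‖h‖
  have hlow : ∀ i x y, φ i x / t ≤ lam i * dist x y - (ψ i y - K) / t := fun i x y => by
    have h1 := neg_le_of_abs_le (abs_apply_le_norm h i (x, y))
    have h2 := hle i x y
    rw [le_sub_iff_add_le, ← add_div, div_le_iff₀ ht]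
    linarith
  have hb : ∀ i x, BddBelow (Set.range fun y => lam i * dist x y - (ψ i y - K) / t) := fun i x =>
    ⟨φ i x / t, by rintro _ ⟨y, rfl⟩; exact hlow i x y⟩
  have hL := fun i => infConv_mem_Lip (hpos i).le (hb i)
  set u : Fin N → X → ℝ := fun i x => ⨅ y, (lam i * dist x y - (ψ i y - K) / t)
  have hL' : ∀ i, (fun x => u i x - K / t) ∈ Lip X (lam i) := fun i x y => by
    simpa using hL i x y
  have hmem := hv _ ⟨fun i x => u i x - K / t, hL', fun x => ?_, rfl⟩
  · have hi : ∀ i, (∫ x, φ i x ∂ν i) / t - K / t ≤ ∫ x, (u i x - K / t) ∂ν i := fun i => by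
      have := (hν i).1
      have : (∫ x, φ i x ∂ν i) / t - K / t = ∫ x, (φ i x / t - K / t) ∂ν i := by
        rw [integral_sub ((hφ i).div_const t) (integrable_const _), integral_div]
        simp
      rw [this]
      refine integral_mono (((hφ i).div_const t).sub (integrable_const _))
        (integrable_of_mem_Lip (hν i) (hL' i)) fun x => ?_
      have : Nonempty X := ⟨x⟩
      exact sub_le_sub_right (le_ciInf fun y => hlow i x y) _
    have hs := (Finset.sum_le_sum fun i (_ : i ∈ Finset.univ) => hi i).trans hmem
    rw [Finset.sum_sub_distrib, ← Finset.sum_div] at hs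
    simp only [Finset.sum_const, Finset.card_univ, Fintype.card_fin, nsmul_eq_mul] at hs
    rw [← mul_div_assoc, ← sub_div, div_le_iff₀ ht] at hs
    linarith
  · have : ∀ i, u i x - K / t ≤ -(ψ i x / t) := fun i => by
      have h1 : u i x ≤ lam i * dist x x - (ψ i x - K) / t := ciInf_le (hb i x) x
      rw [dist_self, mul_zero, sub_div] at h1
      linarith
    refine (Finset.sum_le_sum fun i _ => this i).trans ?_
    rw [Finset.sum_neg_distrib, ← Finset.sum_div, neg_nonpos]
    exact div_nonneg (hψ x) ht.le

/-- Hahn-Banach: a linear functional below the infimum of `gapValues`. -/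
lemma exists_linearMap_le_gapValues (hpos : ∀ i, 0 < lam i) (hν : ∀ i, ν i ∈ P1 X)
    (hv : ∀ s ∈ lipDualValues lam ν, s ≤ v) :
    ∃ ℓ : (Fin N → X × X →ᵇ ℝ) →ₗ[ℝ] ℝ, ∀ h, ∀ r ∈ gapValues lam ν v h, ℓ h ≤ r := by
  set p : (Fin N → X × X →ᵇ ℝ) → ℝ := fun h => sInf (gapValues lam ν v h)
  have hb : ∀ h, BddBelow (gapValues lam ν v h) := fun h =>
    ⟨_, fun r hr => le_of_mem_gapValues hpos hν hv hr⟩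
  have hne : ∀ h, (gapValues lam ν v h).Nonempty := fun h => gapValues_nonempty hpos hν
  have hsmul : ∀ c : ℝ, 0 < c → ∀ h, p (c • h) ≤ c * p h := fun c hc h => by
    rw [← div_le_iff₀' hc]
    refine le_csInf (hne h) fun r hr => ?_
    rw [div_le_iff₀' hc]
    exact csInf_le (hb _) (smul_mem_gapValues hc hr)
  have hhom : ∀ c : ℝ, 0 < c → ∀ h, p (c • h) = c * p h := fun c hc h => by
    refine le_antisymm (hsmul c hc h) ?_
    have h1 := hsmul c⁻¹ (inv_pos.2 hc) (c • h)
    rwa [smul_smul, inv_mul_cancel₀ hc.ne', one_smul, ← div_eq_inv_mul, le_div_iff₀' hc] at h1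
  have hadd : ∀ h k, p (h + k) ≤ p h + p k := fun h k => by
    rw [← sub_le_iff_le_add']
    refine le_csInf (hne k) fun s hs => ?_
    rw [sub_le_comm]
    refine le_csInf (hne h) fun r hr => ?_
    rw [sub_le_iff_le_add]
    exact csInf_le (hb _) (add_mem_gapValues hr hs)
  -- The zero functional on the trivial subspace is extended; this needs only `0 ≤ p 0`, which
  -- follows from `p 0 ≤ 2 * p 0`.
  obtain ⟨ℓ, -, hℓ⟩ := exists_extension_of_le_sublinear
    (⊥ : (Fin N → X × X →ᵇ ℝ) →ₗ.[ℝ] ℝ) p hhom hadd (by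
      rintro ⟨x, hx⟩
      have hx0 : x = 0 := (Submodule.mem_bot ℝ).1 hx
      subst hx0
      have h1 := hsmul 2 two_pos 0
      rw [smul_zero] at h1
      have h2 : (⊥ : (Fin N → X × X →ᵇ ℝ) →ₗ.[ℝ] ℝ) ⟨0, hx⟩ = 0 := map_zero _
      rw [h2]
      simp only
      linarith)
  exact ⟨ℓ, fun h r hr => (hℓ h).trans (csInf_le (hb h) hr)⟩

end HahnBanach

/-! ### Riesz representation on bounded continuous functions under a tightness condition. -/

section Riesz

open scoped BoundedContinuousFunction CompactlySupported

variable {Y : Type*} [MetricSpace Y]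

/-- A continuous cutoff, equal to one on a ball of radius `n` and zero outside radius `n + 1`. -/
def cutoff (a : Y) (n : ℕ) : C(Y, ℝ) where
  toFun y := max 0 (min 1 (n + 1 - dist a y))

lemma cutoff_nonneg (a : Y) (n : ℕ) (y : Y) : 0 ≤ cutoff a n y := le_max_left _ _

lemma cutoff_le_one (a : Y) (n : ℕ) (y : Y) : cutoff a n y ≤ 1 :=
  max_le zero_le_one (min_le_left _ _)

lemma cutoff_eq_one {a : Y} {n : ℕ} {y : Y} (h : dist a y ≤ n) : cutoff a n y = 1 := by
  change max 0 (min 1 ((n : ℝ) + 1 - dist a y)) = 1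
  rw [min_eq_left (by linarith), max_eq_right zero_le_one]

lemma cutoff_eq_zero {a : Y} {n : ℕ} {y : Y} (h : (n : ℝ) + 1 ≤ dist a y) : cutoff a n y = 0 := by
  change max 0 (min 1 ((n : ℝ) + 1 - dist a y)) = 0
  exact max_eq_left ((min_le_right _ _).trans (by linarith))

lemma tendsto_cutoff (a y : Y) : Tendsto (fun n => cutoff a n y) atTop (𝓝 1) := by
  refine tendsto_const_nhds.congr' ?_
  filter_upwards [eventually_ge_atTop ⌈dist a y⌉₊] with n hn
  exact (cutoff_eq_one (Nat.ceil_le.1 hn)).symm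

variable [ProperSpace Y]

/-- The product of a continuous function with the cutoff, as a compactly supported function. -/
def mulCutoff (f : C(Y, ℝ)) (a : Y) (n : ℕ) : C_c(Y, ℝ) where
  toContinuousMap := f * cutoff a n
  hasCompactSupport' := by
    refine HasCompactSupport.intro (isCompact_closedBall a (n + 1)) fun y hy => ?_
    rw [Metric.mem_closedBall, dist_comm, not_le] at hy
    change f y * cutoff a n y = 0
    rw [cutoff_eq_zero hy.le, mul_zero]

lemma mulCutoff_apply (f : C(Y, ℝ)) (a : Y) (n : ℕ) (y : Y) :
    mulCutoff f a n y = f y * cutoff a n y := rfl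

variable [MeasurableSpace Y] [BorelSpace Y]

/-- A positive functional on bounded continuous functions which is small on functions vanishing
near the base point is integration against a finite measure. -/
theorem exists_isFiniteMeasure_integral_eq (a : Y) (L : (Y →ᵇ ℝ) →ₗ[ℝ] ℝ)
    (hL : ∀ f, 0 ≤ f → 0 ≤ L f) (A : ℝ)
    (hA : ∀ n : ℕ, 0 < n → ∀ f : Y →ᵇ ℝ, (∀ y, f y ≤ dist a y / n) → (∀ y, f y ≤ 1) →
      L f ≤ A / n) :
    ∃ γ : Measure Y, IsFiniteMeasure γ ∧ ∀ f : Y →ᵇ ℝ, ∫ y, f y ∂γ = L f := by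
  have hmono : ∀ f g : Y →ᵇ ℝ, (∀ y, f y ≤ g y) → L f ≤ L g := fun f g hfg => by
    have := hL (g - f) fun y => sub_nonneg.2 (hfg y)
    rwa [map_sub, sub_nonneg] at this
  let ι : C_c(Y, ℝ) →ₗ[ℝ] (Y →ᵇ ℝ) :=
    { toFun := fun f => (f : Y →ᵇ ℝ)
      map_add' := fun f g => by ext; rfl
      map_smul' := fun c f => by ext; rfl }
  have hι : ∀ f y, ι f y = f y := fun _ _ => rfl
  let Λ : C_c(Y, ℝ) →ₚ[ℝ] ℝ := PositiveLinearMap.mk₀ (L ∘ₗ ι) fun f hf => hL _ fun y => hf y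
  have hΛ : ∀ f, Λ f = L (ι f) := fun _ => rfl
  set γ := RealRMK.rieszMeasure Λ
  have hint : ∀ f : C_c(Y, ℝ), ∫ y, f y ∂γ = L (ι f) := fun f =>
    (RealRMK.integral_rieszMeasure Λ f).trans (hΛ f)
  -- A cutoff equal to one on the ball lies below the constant `1`, so all balls have mass at most
  -- `L 1`; exhausting the space by balls makes `γ` finite.
  have hball : ∀ n : ℕ, γ (Metric.closedBall a n) ≤ ENNReal.ofReal (L 1) := fun n => by
    refine (RealRMK.rieszMeasure_le_of_eq_one Λ (f := mulCutoff 1 a n) (fun y => ?_)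
      (isCompact_closedBall a n) fun y hy => ?_).trans (ENNReal.ofReal_le_ofReal ?_)
    · rw [mulCutoff_apply]
      exact mul_nonneg zero_le_one (cutoff_nonneg a n y)
    · rw [Metric.mem_closedBall, dist_comm] at hy
      rw [mulCutoff_apply, cutoff_eq_one hy]
      simp
    · rw [hΛ]
      refine hmono _ _ fun y => ?_
      rw [hι, mulCutoff_apply]
      simpa using cutoff_le_one a n y
  have hfin : IsFiniteMeasure γ := by
    refine ⟨lt_of_le_of_lt ?_ (ENNReal.ofReal_lt_top (r := L 1))⟩
    have hm : Monotone fun n : ℕ => Metric.closedBall a n := fun m n hmn =>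
      Metric.closedBall_subset_closedBall (by exact_mod_cast hmn)
    have := tendsto_measure_iUnion_atTop (μ := γ) hm
    rw [Metric.iUnion_closedBall_nat] at this
    exact le_of_tendsto' this hball
  refine ⟨γ, hfin, fun f => ?_⟩
  have h1 : Tendsto (fun n => ∫ y, mulCutoff f a n y ∂γ) atTop (𝓝 (∫ y, f y ∂γ)) := by
    refine tendsto_integral_of_dominated_convergence (fun _ => ‖f‖)
      (fun n => (mulCutoff (f : C(Y, ℝ)) a n).continuous.aestronglyMeasurable)
      (integrable_const _) (fun n => ae_of_all _ fun y => ?_) (ae_of_all _ fun y => ?_)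
    · rw [mulCutoff_apply, norm_mul, Real.norm_of_nonneg (cutoff_nonneg a n y)]
      exact (mul_le_of_le_one_right (norm_nonneg _) (cutoff_le_one a n y)).trans
        (f.norm_coe_le_norm y)
    · simpa [mulCutoff_apply] using (tendsto_cutoff a y).const_mul (f y)
  refine tendsto_nhds_unique h1 ?_
  rw [tendsto_iff_norm_sub_tendsto_zero]
  have h2 : Tendsto (fun n : ℕ => ‖f‖ * (A / n)) atTop (𝓝 0) := by
    simpa using (tendsto_const_div_atTop_nhds_zero_nat A).const_mul ‖f‖
  refine squeeze_zero' (Eventually.of_forall fun _ => norm_nonneg _) ?_ h2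
  filter_upwards [eventually_gt_atTop 0] with n hn
  have hn' : (0 : ℝ) < n := by exact_mod_cast hn
  -- The cutoff error of `f` is at most `‖f‖ * e`, and `e` vanishes on the ball of radius `n`. Hence
  -- `e ≤ dist a y / n`, and the tightness hypothesis makes `L e` of order `1 / n`.
  set e : Y →ᵇ ℝ := 1 - ι (mulCutoff 1 a n) with he
  have hey : ∀ y, e y = 1 - cutoff a n y := fun y => by
    simp [he, hι, mulCutoff_apply]
  have hLe : L e ≤ A / n := by
    refine hA n hn e (fun y => ?_) (fun y => ?_)
    · rw [hey]
      rcases le_total (dist a y) n with h | h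
      · rw [cutoff_eq_one h, sub_self]
        positivity
      · have : 1 ≤ dist a y / n := (one_le_div hn').2 h
        linarith [cutoff_nonneg a n y]
    · rw [hey]
      linarith [cutoff_nonneg a n y]
  have hd : ∀ y, ι (mulCutoff f a n) y - f y = -(f y * e y) := fun y => by
    rw [hι, mulCutoff_apply, hey]
    change f y * cutoff a n y - f y = _
    ring
  have he0 : ∀ y, 0 ≤ e y := fun y => by
    rw [hey]
    linarith [cutoff_le_one a n y]
  have hfe : ∀ y, |f y * e y| ≤ ‖f‖ * e y := fun y => by
    rw [abs_mul, abs_of_nonneg (he0 y)]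
    exact mul_le_mul_of_nonneg_right (f.norm_coe_le_norm y) (he0 y)
  rw [hint, ← map_sub, Real.norm_eq_abs]
  have hup : L (ι (mulCutoff f a n) - f) ≤ ‖f‖ * L e := by
    rw [← smul_eq_mul, ← map_smul]
    refine hmono _ _ fun y => ?_
    have := neg_le_of_abs_le (hfe y)
    simp only [BoundedContinuousFunction.coe_sub, Pi.sub_apply, hd,
      BoundedContinuousFunction.coe_smul, smul_eq_mul]
    linarith
  have hlow : -(‖f‖ * L e) ≤ L (ι (mulCutoff f a n) - f) := by
    rw [← smul_eq_mul, ← map_smul, ← map_neg]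
    refine hmono _ _ fun y => ?_
    have := le_of_abs_le (hfe y)
    simp only [BoundedContinuousFunction.coe_sub, Pi.sub_apply, hd,
      BoundedContinuousFunction.coe_smul, smul_eq_mul, BoundedContinuousFunction.coe_neg,
      Pi.neg_apply]
    linarith
  exact (abs_le.2 ⟨hlow, hup⟩).trans (mul_le_mul_of_nonneg_left hLe (norm_nonneg _))

end Riesz

/-! ### Optimal plans and the median. -/

section OptimalPlans

open scoped BoundedContinuousFunction

/-- The scaled distance truncated at height `n`, as a bounded continuous function. -/
def truncDist (X : Type*) [MetricSpace X] (l : ℝ) (n : ℕ) : X × X →ᵇ ℝ :=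
  BoundedContinuousFunction.ofNormedAddCommGroup (fun p => max 0 (min (n : ℝ) (l * dist p.1 p.2)))
    (by fun_prop) n fun p => by
      rw [Real.norm_of_nonneg (le_max_left _ _)]
      exact max_le (Nat.cast_nonneg n) (min_le_left _ _)

lemma truncDist_apply {X : Type*} [MetricSpace X] {l : ℝ} (hl : 0 ≤ l) (n : ℕ) (p : X × X) :
    truncDist X l n p = min (n : ℝ) (l * dist p.1 p.2) :=
  max_eq_right (le_min (Nat.cast_nonneg n) (mul_nonneg hl dist_nonneg))

lemma tendsto_lintegral_truncDist {X : Type*} [MetricSpace X] [SecondCountableTopology X]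
    [MeasurableSpace X] [BorelSpace X] {l : ℝ} (hl : 0 ≤ l) (γ : Measure (X × X)) :
    Tendsto (fun n => ∫⁻ p, ENNReal.ofReal (truncDist X l n p) ∂γ) atTop
      (𝓝 (ENNReal.ofReal l * ∫⁻ p, edist p.1 p.2 ∂γ)) := by
  rw [← lintegral_const_mul _ (by fun_prop)]
  refine lintegral_tendsto_of_tendsto_of_monotone
    (fun n => (truncDist X l n).continuous.measurable.ennreal_ofReal.aemeasurable)
    (ae_of_all _ fun p m n hmn => ?_) (ae_of_all _ fun p => ?_)
  · simp only [truncDist_apply hl]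
    refine ENNReal.ofReal_le_ofReal (min_le_min_right _ ?_)
    exact_mod_cast hmn
  · rw [edist_dist, ← ENNReal.ofReal_mul hl]
    refine tendsto_const_nhds.congr' ?_
    filter_upwards [eventually_ge_atTop ⌈l * dist p.1 p.2⌉₊] with n hn
    rw [truncDist_apply hl, min_eq_right (Nat.ceil_le.1 hn)]

variable {X : Type*} [MetricSpace X] [MeasurableSpace X] {N : ℕ}
  {lam : Fin N → ℝ} {ν : Fin N → Measure X} {v : ℝ}

/-- When the constraint holds without using the cost, every `t > 0` is allowed; letting `t` tend to
zero removes the term `t * v`. -/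
lemma le_of_le_gapValues_of_le_zero {ℓ : (Fin N → X × X →ᵇ ℝ) →ₗ[ℝ] ℝ}
    (hℓ : ∀ h, ∀ r ∈ gapValues lam ν v h, ℓ h ≤ r) (hpos : ∀ i, 0 < lam i)
    {h : Fin N → X × X →ᵇ ℝ} {φ ψ : Fin N → X → ℝ} (hφ : ∀ i, Integrable (φ i) (ν i))
    (hle : ∀ i x y, h i (x, y) + φ i x + ψ i y ≤ 0) (hψ : ∀ y, 0 ≤ ∑ i, ψ i y) :
    ℓ h ≤ - ∑ i, ∫ x, φ i x ∂ν i := by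
  have h1 : Tendsto (fun t : ℝ => t * v - ∑ i, ∫ x, φ i x ∂ν i) (𝓝[>] 0)
      (𝓝 (0 * v - ∑ i, ∫ x, φ i x ∂ν i)) :=
    (Continuous.tendsto (by fun_prop) 0).mono_left nhdsWithin_le_nhds
  rw [zero_mul, zero_sub] at h1
  refine ge_of_tendsto h1 ?_
  filter_upwards [self_mem_nhdsWithin] with t (ht : 0 < t)
  refine hℓ h _ ⟨t, ht, φ, ψ, hφ, fun i x y => (hle i x y).trans ?_, hψ, rfl⟩
  have := (hpos i).le
  positivity

variable [BorelSpace X] [ProperSpace X]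

/-- Plans with a common second marginal whose total cost is at most any upper bound of the
Lipschitz dual problem. -/
lemma exists_plans (x₀ : X) (hpos : ∀ i, 0 < lam i) (hν : ∀ i, ν i ∈ P1 X)
    (hv : ∀ s ∈ lipDualValues lam ν, s ≤ v) :
    ∃ γ : Fin N → Measure (X × X), (∀ i, IsProbabilityMeasure (γ i)) ∧
      (∀ i, (γ i).map Prod.fst = ν i) ∧
      (∀ i j, (γ i).map Prod.snd = (γ j).map Prod.snd) ∧
      ∑ i, ENNReal.ofReal (lam i) * ∫⁻ p, edist p.1 p.2 ∂γ i ≤ ENNReal.ofReal v := by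
  obtain ⟨ℓ, hℓ⟩ := exists_linearMap_le_gapValues hpos hν hv
  let L : Fin N → (X × X →ᵇ ℝ) →ₗ[ℝ] ℝ := fun i =>
    ℓ ∘ₗ LinearMap.single ℝ (fun _ : Fin N => X × X →ᵇ ℝ) i
  have hLdef : ∀ i f, L i f = ℓ (Pi.single i f) := fun _ _ => rfl
  have hLnonneg : ∀ i f, 0 ≤ f → 0 ≤ L i f := fun i f hf => by
    rw [← neg_nonpos, ← map_neg, hLdef]
    have := le_of_le_gapValues_of_le_zero hℓ hpos (h := Pi.single i (-f)) (φ := 0) (ψ := 0)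
      (fun i => integrable_zero _ _ _) (fun j x y => ?_) (by simp)
    · simpa using this
    · rcases eq_or_ne j i with rfl | hij
      · simpa using hf (x, y)
      · simp [hij]
  have hLtight : ∀ i, ∀ n : ℕ, 0 < n → ∀ f : X × X →ᵇ ℝ, (∀ p, f p ≤ dist (x₀, x₀) p / n) →
      (∀ p, f p ≤ 1) → L i f ≤ (v / lam i + ∫ x, dist x₀ x ∂ν i) / n := fun i n hn f hf _ => by
    have hn' : (0 : ℝ) < n := by exact_mod_cast hn
    have hi := hpos i
    -- Since `dist (x₀, x₀) (x, y) ≤ dist x₀ x + dist x y`, the second term over `n` is paid for by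
    -- the cost with `t = 1 / (n * lam i)`, the first by `φ i`.
    refine (hℓ (Pi.single i f) _ ⟨1 / (n * lam i), by positivity,
      Pi.single i fun x => -(dist x₀ x / n), 0, fun j => ?_, fun j x y => ?_, by simp, rfl⟩).trans ?_
    · rcases eq_or_ne j i with rfl | hij
      · simpa using ((integrable_dist (hν j) x₀).div_const n).neg
      · simp [hij]
    · rcases eq_or_ne j i with rfl | hij
      · have h1 := hf (x, y)
        have h2 : dist (x₀, x₀) (x, y) ≤ dist x₀ x + dist x y := by
          rw [Prod.dist_eq]
          exact max_le (le_add_of_nonneg_right dist_nonneg) (dist_triangle _ _ _)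
        have h3 := div_le_div_of_nonneg_right h2 hn'.le
        have h4 : 1 / (n * lam j) * (lam j * dist x y) = dist x y / n := by field_simp
        rw [add_div] at h3
        simp only [Pi.single_eq_same, Pi.zero_apply, h4]
        linarith
      · have := (hpos j).le
        simp only [Pi.single_eq_of_ne hij, Pi.zero_apply, BoundedContinuousFunction.coe_zero,
          add_zero]
        positivity
    · rw [Finset.sum_eq_single i (fun j _ hij => by simp [hij]) (by simp)]
      simp only [Pi.single_eq_same, integral_neg, integral_div]
      apply le_of_eq
      field_simp
      ring
  choose γ hγfin hγ using fun i =>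
    exists_isFiniteMeasure_integral_eq (x₀, x₀) (L i) (hLnonneg i) _ (hLtight i)
  have hfst_le : ∀ i (b : X →ᵇ ℝ), L i (b.compContinuous ⟨Prod.fst, continuous_fst⟩)
      ≤ ∫ x, b x ∂ν i := fun i b => by
    have := (hν i).1
    have := le_of_le_gapValues_of_le_zero hℓ hpos
      (h := Pi.single i (b.compContinuous ⟨Prod.fst, continuous_fst⟩))
      (φ := Pi.single i fun x => -b x) (ψ := 0) (fun j => ?_) (fun j x y => ?_) (by simp)
    · rw [Finset.sum_eq_single i (fun j _ hij => by simp [hij]) (by simp)] at this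
      simpa [integral_neg, hLdef] using this
    · rcases eq_or_ne j i with rfl | hij
      · simpa using (b.integrable (ν j)).neg
      · simp [hij]
    · rcases eq_or_ne j i with rfl | hij
      · simp
      · simp [hij]
  have hfst : ∀ i, (γ i).map Prod.fst = ν i := fun i => by
    have := (hν i).1
    refine ext_of_forall_integral_eq_of_IsFiniteMeasure fun b => ?_
    rw [integral_map measurable_fst.aemeasurable b.continuous.aestronglyMeasurable]
    refine (hγ i (b.compContinuous ⟨Prod.fst, continuous_fst⟩)).trans (le_antisymm (hfst_le i b) ?_)
    -- Applying the one-sided bound to `-b` as well upgrades it to an equality.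
    have h1 := hfst_le i (-b)
    have h2 : (-b).compContinuous ⟨Prod.fst, continuous_fst⟩
        = -(b.compContinuous (⟨Prod.fst, continuous_fst⟩ : C(X × X, X))) := rfl
    rw [h2, map_neg] at h1
    simp only [BoundedContinuousFunction.coe_neg, Pi.neg_apply, integral_neg] at h1
    linarith
  have hprob : ∀ i, IsProbabilityMeasure (γ i) := fun i => by
    have := (hν i).1
    refine ⟨?_⟩
    rw [← Set.preimage_univ (f := Prod.fst), ← Measure.map_apply measurable_fst MeasurableSet.univ,
      hfst i, measure_univ]
  have hsnd_le : ∀ i j (b : X →ᵇ ℝ), L i (b.compContinuous ⟨Prod.snd, continuous_snd⟩)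
      ≤ L j (b.compContinuous ⟨Prod.snd, continuous_snd⟩) := fun i j b => by
    rcases eq_or_ne i j with rfl | hij
    · rfl
    rw [← sub_nonpos, hLdef, hLdef, ← map_sub]
    -- With `-b` in slot `i` and `b` in slot `j`, `ψ` cancels `h` exactly and has zero sum.
    have := le_of_le_gapValues_of_le_zero hℓ hpos
      (h := Pi.single i (b.compContinuous ⟨Prod.snd, continuous_snd⟩)
        - Pi.single j (b.compContinuous ⟨Prod.snd, continuous_snd⟩))
      (φ := 0) (ψ := fun k y => Pi.single (M := fun _ => ℝ) j (b y) k
        - Pi.single (M := fun _ => ℝ) i (b y) k) (fun i => integrable_zero _ _ _)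
      (fun k x y => ?_) (fun y => ?_)
    · simpa using this
    · rcases eq_or_ne k i with rfl | hki
      · simp [hij]
      · rcases eq_or_ne k j with rfl | hkj
        · simp [hki]
        · simp [hki, hkj]
    · rw [Finset.sum_sub_distrib]
      simp
  have hsnd : ∀ i j, (γ i).map Prod.snd = (γ j).map Prod.snd := fun i j => by
    refine ext_of_forall_integral_eq_of_IsFiniteMeasure fun b => ?_
    rw [integral_map measurable_snd.aemeasurable b.continuous.aestronglyMeasurable,
      integral_map measurable_snd.aemeasurable b.continuous.aestronglyMeasurable]
    refine (hγ i (b.compContinuous ⟨Prod.snd, continuous_snd⟩)).trans ((le_antisymm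
      (hsnd_le i j b) (hsnd_le j i b)).trans
      (hγ j (b.compContinuous ⟨Prod.snd, continuous_snd⟩)).symm)
  refine ⟨γ, hprob, hfst, hsnd, ?_⟩
  -- The functional only sees bounded functions, so the cost is truncated at height `n`; the bound
  -- by `v` comes from `t = 1`, `φ = ψ = 0`, and monotone convergence removes the truncation.
  refine le_of_tendsto' (tendsto_finsetSum _ fun i _ =>
    tendsto_lintegral_truncDist (hpos i).le (γ i)) fun n => ?_
  have hnn : ∀ i p, 0 ≤ truncDist X (lam i) n p := fun i p => le_max_left _ _
  have h1 : ∀ i, ∫⁻ p, ENNReal.ofReal (truncDist X (lam i) n p) ∂γ i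
      = ENNReal.ofReal (L i (truncDist X (lam i) n)) := fun i => by
    rw [← hγ, ofReal_integral_eq_lintegral_ofReal ((truncDist X (lam i) n).integrable _)
      (ae_of_all _ (hnn i))]
  simp_rw [h1]
  rw [← ENNReal.ofReal_sum_of_nonneg fun i _ => hLnonneg i _ (hnn i)]
  refine ENNReal.ofReal_le_ofReal ?_
  simp_rw [hLdef]
  rw [← map_sum, Finset.univ_sum_single]
  refine hℓ _ _ ⟨1, one_pos, 0, 0, fun i => integrable_zero _ _ _, fun i x y => ?_, by simp,
    by simp⟩
  simp [truncDist_apply (hpos i).le]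

lemma exists_dispersion_le [NeZero N] (x₀ : X) (hpos : ∀ i, 0 < lam i) (hν : ∀ i, ν i ∈ P1 X)
    (hv : ∀ s ∈ lipDualValues lam ν, s ≤ v) :
    ∃ μ ∈ P1 X, dispersion lam ν μ ≤ ENNReal.ofReal v := by
  obtain ⟨γ, hprob, hfst, hsnd, hle⟩ := exists_plans x₀ hpos hν hv
  refine ⟨(γ 0).map Prod.snd, ⟨Measure.isProbabilityMeasure_map measurable_snd.aemeasurable,
    x₀, ?_⟩, (Finset.sum_le_sum fun i _ => ?_).trans hle⟩
  · have h1 : Integrable (fun p : X × X => dist x₀ p.1) (γ 0) := by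
      have := integrable_dist (hν 0) x₀
      rw [← hfst 0] at this
      exact this.comp_measurable measurable_fst
    -- The term with index `0` of the finite total cost is finite and has positive weight. With the
    -- first moment of `ν 0` this gives the second marginal a finite first moment.
    have h2 : Integrable (fun p : X × X => dist p.1 p.2) (γ 0) := by
      refine ⟨Continuous.aestronglyMeasurable (by fun_prop), ?_⟩
      have hlt := ((Finset.single_le_sum (fun _ _ => zero_le)
        (Finset.mem_univ (0 : Fin N))).trans hle).trans_lt ENNReal.ofReal_lt_top
      rw [HasFiniteIntegral]
      have h3 : ∀ p : X × X, ‖dist p.1 p.2‖ₑ = edist p.1 p.2 := fun p => by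
        rw [edist_dist, Real.enorm_of_nonneg dist_nonneg]
      simp_rw [h3]
      exact ENNReal.lt_top_of_mul_ne_top_right hlt.ne (by simpa using hpos 0)
    have h4 : Integrable (fun p : X × X => dist x₀ p.2) (γ 0) :=
      (h1.add h2).mono' (Continuous.aestronglyMeasurable (by fun_prop))
        (ae_of_all _ fun p => by simpa using dist_triangle x₀ p.1 p.2)
    exact (integrable_map_measure (Continuous.aestronglyMeasurable (by fun_prop))
      measurable_snd.aemeasurable).2 h4
  · gcongr
    exact iInf₂_le (γ i) ⟨hprob i, hfst i, hsnd i 0⟩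

end OptimalPlans

end WassersteinMedian

theorem mainTheorem8 {X : Type*} [MetricSpace X] [ProperSpace X] [MeasurableSpace X]
    [BorelSpace X] (x₀ : X) (N : ℕ) (lam : Fin N → ℝ) (hlam : lam ∈ stdSimplex ℝ (Fin N))
    (hpos : ∀ i, 0 < lam i) (ν : Fin N → Measure X) (hν : ∀ i, ν i ∈ WassersteinMedian.P1 X) :
    ∃ v : ℝ,
      IsLeast (WassersteinMedian.medianValues lam ν) (v : EReal) ∧
      IsLUB (WassersteinMedian.relaxedDualValues x₀ lam ν) (v : EReal) ∧
      IsGreatest (WassersteinMedian.lipDualValues lam ν) v := by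
  have : NeZero N := ⟨by rintro rfl; simpa using hlam.2⟩
  obtain ⟨v, hv⟩ := WassersteinMedian.exists_isGreatest_lipDualValues hpos hν x₀
  have hv0 : 0 ≤ v := hv.2 (WassersteinMedian.zero_mem_lipDualValues hpos)
  have hcoe : ((ENNReal.ofReal v : ℝ≥0∞) : EReal) = (v : EReal) := by
    rw [EReal.coe_ennreal_ofReal, max_eq_left hv0]
  refine ⟨v, ⟨?_, ?_⟩, ⟨?_, ?_⟩, hv⟩
  -- That `v` bounds the dual values (`hv.2`) produces the median; that `v` is itself a dual value
  -- (`hv.1`) gives the matching lower bound.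
  · obtain ⟨μ, hμ, hle⟩ := WassersteinMedian.exists_dispersion_le x₀ hpos hν hv.2
    refine ⟨μ, hμ, ?_⟩
    rw [le_antisymm hle (WassersteinMedian.ofReal_le_dispersion hpos hν hμ hv.1), hcoe]
  · rintro _ ⟨μ, hμ, rfl⟩
    rw [← hcoe, EReal.coe_ennreal_le_coe_ennreal_iff]
    exact WassersteinMedian.ofReal_le_dispersion hpos hν hμ hv.1
  · intro r hr
    rcases WassersteinMedian.relaxedDualValue_eq_bot_or_mem hpos hν x₀ hr with rfl | ⟨s, hs, rfl⟩
    · exact bot_le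
    · exact EReal.coe_le_coe_iff.2 (hv.2 hs)
  · intro b hb
    obtain ⟨r, hr, hle⟩ := WassersteinMedian.exists_relaxedDualValue_ge hpos hν x₀ hv.1
    exact hle.trans (hb hr)
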